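/- Let $\lambda$ be a Young diagram with $n$ boxes, each box being identified with the pair $(i,j)$ of its column number $i$ and its row number $j$. Let $\rho^\lambda$ be the corresponding irreducible complex representation of the symmetric group $S_n$, that is, the left ideal $\mathbb{C}[S_n]\,b_\lambda a_\lambda$ with $S_n$ acting by left multiplication, where the boxes are numbered by $1,\dots,n$, $a_\lambda$ is the sum of all permutations preserving each row, and $b_\lambda$ is the sum of all permutations preserving each column, weighted by their signs. For $l\le n$ and $\pi\in S_l\subseteq S_n$ (extended by fixed points) define the normalized character $$\Sigma^\lambda(\pi)=n(n-1)\cdots(n-l+1)\,\frac{\operatorname{Tr}\rho^\lambda(\pi)}{\operatorname{Tr}\rho^\lambda(e)} .$$ Let $N$ be at least the number of rows and the number of columns of $\lambda$, and let $T_\lambda=(t_{ij})_{1\le i,j\le N}$ be a random matrix with independent entries such that, if $(i,j)\in\lambda$, then $t_{ij}$ is a complex centered Gaussian variable with $$\mathbb{E}(t_{ij})=0,\qquad \mathbb{E}(t_{ij}\overline{t_{ij}})=1,\qquad \mathbb{E}(t_{ij}^2)=0,$$ and $t_{ij}=0$ almost surely if $(i,j)\notin\lambda$. Then for every $l\le n$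 and every permutation $\pi\in S_l$ with cycle lengths $k_1,\dots,k_r$ (fixed points counted as cycles of length $1$, so that $k_1+\cdots+k_r=l$), the random variable $\prod_{i=1}^r\operatorname{Tr}\big((T_\lambda T_\lambda^\star)^{k_i}\big)$ is integrable, its expectation is real, and $$|\Sigma^\lambda(\pi)|\le \mathbb{E}\Big(\operatorname{Tr}\big((T_\lambda T_\lambda^\star)^{k_1}\big)\cdots \operatorname{Tr}\big((T_\lambda T_\lambda^\star)^{k_r}\big)\Big).$$ -/

import Mathlib

open MeasureTheory ProbabilityTheory
open scoped Matrix ComplexConjugate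

noncomputable section

namespace YoungDiagram

/-- The group algebra `ℂ[S̃_n]` of the group of permutations of the boxes of `lam`. -/
abbrev BoxAlgebra (lam : YoungDiagram) : Type := MonoidAlgebra ℂ (Equiv.Perm lam.cells)

open Classical in
/-- The permutations of the boxes which preserve each row
(in Mathlib a box is a pair (row, column)). -/
def rowGroup (lam : YoungDiagram) : Finset (Equiv.Perm lam.cells) :=
  Finset.univ.filter fun s => ∀ x : lam.cells, (s x).1.1 = x.1.1

open Classical in
/-- The permutations of the boxes which preserve each column. -/
def colGroup (lam : YoungDiagram) : Finset (Equiv.Perm lam.cells) :=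
  Finset.univ.filter fun s => ∀ x : lam.cells, (s x).1.2 = x.1.2

/-- The Young symmetrizer `c = b a`, where `a` is the sum of the row group and `b` is the signed
sum of the column group. -/
def symmetrizer (lam : YoungDiagram) : lam.BoxAlgebra :=
  (∑ s ∈ lam.colGroup, MonoidAlgebra.single s ((Equiv.Perm.sign s : ℤ) : ℂ)) *
    (∑ s ∈ lam.rowGroup, MonoidAlgebra.single s (1 : ℂ))

/-- The left ideal `V = ℂ[S̃_n] c` generated by the Young symmetrizer. -/
def irrepSpace (lam : YoungDiagram) : Submodule ℂ lam.BoxAlgebra :=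
  LinearMap.range (LinearMap.mulRight ℂ lam.symmetrizer)

theorem mulLeft_mem_irrepSpace (lam : YoungDiagram) (a : lam.BoxAlgebra) :
    ∀ v ∈ lam.irrepSpace, LinearMap.mulLeft ℂ a v ∈ lam.irrepSpace := by
  rintro _ ⟨w, rfl⟩
  exact ⟨a * w, by simp [mul_assoc]⟩

/-- The irreducible representation attached to `lam` of the group of permutations of its boxes:
left multiplication on `V`. -/
def boxIrrep (lam : YoungDiagram) :
    Representation ℂ (Equiv.Perm lam.cells) lam.irrepSpace where
  toFun s := (LinearMap.mulLeft ℂ (MonoidAlgebra.single s (1 : ℂ))).restrict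
    (lam.mulLeft_mem_irrepSpace _)
  map_one' := by
    ext v
    simp [← MonoidAlgebra.one_def]
  map_mul' s t := by
    ext v
    simp [← mul_assoc, MonoidAlgebra.single_mul_single]

/-- The irreducible representation `ρ^lam` of `S_n`, `n = |lam|`, obtained by numbering the boxes.
(Another numbering gives an isomorphic representation.) -/
def irrep (lam : YoungDiagram) :
    Representation ℂ (Equiv.Perm (Fin lam.card)) lam.irrepSpace :=
  lam.boxIrrep.comp (lam.cells.equivFin.symm.permCongrHom).toMonoidHom

/-- The character `χ^lam(π) = Tr ρ^lam(π) / Tr ρ^lam(e)`. -/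
def chi (lam : YoungDiagram) (π : Equiv.Perm (Fin lam.card)) : ℂ :=
  LinearMap.trace ℂ lam.irrepSpace (lam.irrep π) / LinearMap.trace ℂ lam.irrepSpace (lam.irrep 1)

/-- The normalized character `Σ^lam(π) = n (n-1) ⋯ (n-l+1) χ^lam(π)` of `π ∈ S_l`, `l ≤ n`,
where `π` is seen in `S_n` by letting it fix the last `n - l` points. -/
def normalizedChar (lam : YoungDiagram) {l : ℕ} (hl : l ≤ lam.card)
    (π : Equiv.Perm (Fin l)) : ℂ :=
  (lam.card.descFactorial l : ℂ) * lam.chi (π.viaEmbedding (Fin.castLEEmb hl))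

/-- `T` is the random `N × N` matrix `T_lam = (t i j)`: the entries are independent; the entry is a
complex centered Gaussian variable with `E |t i j|² = 1` and `E (t i j)² = 0` if `lam` has a box
in column `i` and row `j`, and it vanishes otherwise. -/
structure IsGaussianMatrix (lam : YoungDiagram) {Ω : Type*} [MeasurableSpace Ω] (P : Measure Ω)
    {N : ℕ} (T : Ω → Matrix (Fin N) (Fin N) ℂ) : Prop where
  indep : iIndepFun (fun (p : Fin N × Fin N) (ω : Ω) => T ω p.1 p.2) P
  gaussian : ∀ i j : Fin N, ((j : ℕ), (i : ℕ)) ∈ lam → HasGaussianLaw (fun ω => T ω i j) P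
  mean : ∀ i j : Fin N, ((j : ℕ), (i : ℕ)) ∈ lam → ∫ ω, T ω i j ∂P = 0
  variance : ∀ i j : Fin N, ((j : ℕ), (i : ℕ)) ∈ lam → ∫ ω, T ω i j * conj (T ω i j) ∂P = 1
  pseudovariance : ∀ i j : Fin N, ((j : ℕ), (i : ℕ)) ∈ lam → ∫ ω, T ω i j ^ 2 ∂P = 0
  zero : ∀ i j : Fin N, ((j : ℕ), (i : ℕ)) ∉ lam → ∀ᵐ ω ∂P, T ω i j = 0

end YoungDiagram

/-- The product of `Tr ((A A*)^k)` over the lengths `k` of all cycles of `π`, where a fixed point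
is a cycle of length one. -/
def cycleTraceProd {l N : ℕ} (π : Equiv.Perm (Fin l)) (A : Matrix (Fin N) (Fin N) ℂ) : ℂ :=
  (π.partition.parts.map fun k => ((A * Aᴴ) ^ k).trace).prod

end

/-!
Write `c` for the Young symmetrizer. Since `c * c = α • c`, left multiplication by `g` on the ideal
`ℂ[S_n] c` has trace `α⁻¹ ∑ h, c (h⁻¹ g⁻¹ h)`, so that `Σ^lam(π)` is the sum of the coefficients of
`c` at the permutations `π⁻¹` transported along all injections `F` of the `l` points into the boxes.
The coefficient of `c` at `w` is a signed count of the row permutations `p` with `w p` in the column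
group; for `w = π⁻¹` transported along `F` such a `p` comes from a permutation `σ` of the `l` points
for which `F` and `F ∘ σ` agree in the row, and `F` and `F ∘ π⁻¹ σ` in the column.

The expectation of the trace product counts the same pairs `(F, σ)` without signs and without the
requirement that `F` be injective: expanding the traces gives a sum over all labellings `F`, and
Wick's formula turns each summand into the number of the corresponding `σ`.
-/

noncomputable section

section PermTrace

variable {ι R β γ : Type*} [Fintype ι] [CommSemiring R] [Fintype β] [DecidableEq β] [Fintype γ]
  [DecidableEq γ]

/-- The trace of `M^{⊗β}` composed with the permutation `σ` of the tensor factors, written as a sum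
over the basis vectors `a : β → ι`. -/
def permTrace (M : Matrix ι ι R) (σ : Equiv.Perm β) : R :=
  ∑ a : β → ι, ∏ m, M (a m) (a (σ m))

theorem permTrace_eq_of_semiconj (M : Matrix ι ι R) {σ : Equiv.Perm β} {τ : Equiv.Perm γ}
    (e : β ≃ γ) (h : Function.Semiconj e σ τ) : permTrace M σ = permTrace M τ := by
  unfold permTrace
  rw [← (e.arrowCongr (Equiv.refl ι)).sum_comp]
  refine Finset.sum_congr rfl fun a _ => ?_
  rw [← e.prod_comp]
  simp [← h.eq]

theorem permTrace_one (M : Matrix ι ι R) :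
    permTrace M (1 : Equiv.Perm β) = M.trace ^ Fintype.card β := by
  have expand := Fintype.piFinset_univ (α := β) (β := fun _ => ι) ▸
    Finset.prod_univ_sum (fun _ : β => (Finset.univ : Finset ι)) (fun _ i => M i i)
  simpa [permTrace, Matrix.trace] using expand.symm

theorem permTrace_sumCongr (M : Matrix ι ι R) (σ : Equiv.Perm β) (τ : Equiv.Perm γ) :
    permTrace M (Equiv.sumCongr σ τ) = permTrace M σ * permTrace M τ := by
  unfold permTrace
  rw [← (Equiv.sumArrowEquivProdArrow β γ ι).symm.sum_comp, Fintype.sum_prod_type,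
    Finset.sum_mul_sum]
  simp [Equiv.sumArrowEquivProdArrow]

theorem permTrace_eq_mul_subtypePerm (M : Matrix ι ι R) (σ : Equiv.Perm β) (p : β → Prop)
    [Fintype {x // p x}] [Fintype {x // ¬ p x}] (h : ∀ x, p (σ x) ↔ p x) :
    permTrace M σ = permTrace M (σ.subtypePerm h) *
      permTrace M (σ.subtypePerm (p := fun x => ¬ p x) fun x => not_congr (h x)) := by
  classical
  rw [← permTrace_sumCongr]
  refine (permTrace_eq_of_semiconj M (Equiv.sumCompl p) ?_).symm
  rintro (x | x) <;> simp

theorem sum_prod_path_mul [DecidableEq ι] (M M' : Matrix ι ι R) (k : ℕ) :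
    ∑ a : Fin (k + 1) → ι, (∏ i : Fin k, M (a i.castSucc) (a i.succ)) * M' (a (Fin.last k)) (a 0) =
      (M ^ k * M').trace := by
  induction k generalizing M' with
  | zero =>
    rw [← (Equiv.funUnique (Fin 1) ι).symm.sum_comp]
    simp [Matrix.trace]
  | succ k ih =>
    rw [← (Fin.snocEquiv fun _ => ι).sum_comp, Fintype.sum_prod_type, Finset.sum_comm, pow_succ,
      mul_assoc, ← ih]
    refine Finset.sum_congr rfl fun a _ => ?_
    rw [Matrix.mul_apply, Finset.mul_sum]
    refine Finset.sum_congr rfl fun x _ => ?_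
    have snoc_zero : (Fin.snoc a x : Fin (k + 2) → ι) 0 = a 0 := by
      rw [← Fin.castSucc_zero, Fin.snoc_castSucc (α := fun _ => ι)]
    have snoc_succ (i : Fin k) : (Fin.snoc a x : Fin (k + 2) → ι) i.castSucc.succ = a i.succ := by
      rw [Fin.succ_castSucc, Fin.snoc_castSucc (α := fun _ => ι)]
    rw [Fin.prod_univ_castSucc]
    simp only [Fin.snocEquiv_apply, Fin.snoc_castSucc (α := fun _ => ι), snoc_zero, snoc_succ,
      Fin.succ_last, Fin.snoc_last (α := fun _ => ι)]
    ring

theorem permTrace_finRotate [DecidableEq ι] (M : Matrix ι ι R) (k : ℕ) :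
    permTrace M (finRotate (k + 1)) = (M ^ (k + 1)).trace := by
  rw [pow_succ, ← sum_prod_path_mul]
  refine Finset.sum_congr rfl fun a _ => ?_
  rw [Fin.prod_univ_castSucc]
  simp

theorem exists_semiconj_finRotate_of_isCycleOn {β : Type*} {σ : Equiv.Perm β} {s : Finset β}
    (hσ : σ.IsCycleOn s) {k : ℕ} (hk : s.card = k + 1) :
    ∃ e : Fin (k + 1) ≃ s,
      Function.Semiconj e (finRotate (k + 1)) (σ.subtypePerm fun _ => hσ.apply_mem_iff) := by
  obtain ⟨x, hx⟩ : s.Nonempty := Finset.card_pos.1 (by lia)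
  let orbit (i : Fin (k + 1)) : s :=
    ⟨(σ ^ (i : ℕ)) x, (hσ.1.perm_pow i).mapsTo hx⟩
  have surjective : Function.Surjective orbit := fun y => by
    obtain ⟨n, hn, hy⟩ := hσ.exists_pow_eq hx y.2
    exact ⟨⟨n, hk ▸ hn⟩, Subtype.ext hy⟩
  have bijective : Function.Bijective orbit :=
    (Fintype.bijective_iff_surjective_and_card orbit).2 ⟨surjective, by simp [hk]⟩
  refine ⟨Equiv.ofBijective orbit bijective, fun i => Subtype.ext ?_⟩
  change (σ ^ (finRotate (k + 1) i : ℕ)) x = σ ((σ ^ (i : ℕ)) x)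
  rw [← Equiv.Perm.mul_apply, ← pow_succ', hσ.pow_apply_eq_pow_apply hx, hk, finRotate_apply,
    Fin.val_add, Fin.val_one']
  exact ((Nat.mod_modEq _ _).trans ((Nat.mod_modEq _ _).add_left _))

theorem permTrace_subtypePerm_of_isCycleOn [DecidableEq ι] {β : Type*} [DecidableEq β]
    (M : Matrix ι ι R) {σ : Equiv.Perm β} {s : Finset β} (hσ : σ.IsCycleOn s) (hs : s.Nonempty) :
    permTrace M (σ.subtypePerm (p := (· ∈ s)) fun _ => hσ.apply_mem_iff) =
      (M ^ s.card).trace := by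
  obtain ⟨k, hk⟩ := Nat.exists_eq_add_one.2 hs.card_pos
  obtain ⟨e, he⟩ := exists_semiconj_finRotate_of_isCycleOn hσ hk
  rw [← permTrace_eq_of_semiconj M e he, permTrace_finRotate, hk]

theorem cycleType_eq_cons_of_mem_cycleFactorsFinset {σ c : Equiv.Perm β}
    (hc : c ∈ σ.cycleFactorsFinset) :
    σ.cycleType = c.support.card ::ₘ (σ.subtypePerm (p := fun x => x ∉ c.support) fun x =>
      not_congr (Equiv.Perm.mem_cycleFactorsFinset_support hc x)).cycleType := by
  have hcycle := Equiv.Perm.mem_cycleFactorsFinset_iff.1 hc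
  rw [← Equiv.Perm.cycleType_ofSubtype]
  have hrest : Equiv.Perm.ofSubtype (σ.subtypePerm (p := fun x => x ∉ c.support) fun x =>
      not_congr (Equiv.Perm.mem_cycleFactorsFinset_support hc x)) = σ * c⁻¹ := by
    ext x
    by_cases hx : x ∈ c.support
    · rw [Equiv.Perm.ofSubtype_apply_of_not_mem (p := fun x => x ∉ c.support) _
        (not_not_intro hx), Equiv.Perm.mul_apply,
        ← hcycle.2 _ ((Equiv.Perm.apply_mem_support).1 (by simpa using hx))]
      simp
    · have hfix : c⁻¹ x = x := Equiv.Perm.inv_eq_iff_eq.2 (Equiv.Perm.notMem_support.1 hx).symm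
      rw [Equiv.Perm.ofSubtype_apply_of_mem (p := fun x => x ∉ c.support) _ hx,
        Equiv.Perm.subtypePerm_apply, Equiv.Perm.mul_apply, hfix]
  have hmul : σ = c * (σ * c⁻¹) := by
    rw [← (Equiv.Perm.disjoint_mul_inv_of_mem_cycleFactorsFinset hc).commute.eq]
    simp
  rw [hrest]
  conv_lhs => rw [hmul]
  rw [(Equiv.Perm.disjoint_mul_inv_of_mem_cycleFactorsFinset hc).symm.cycleType_mul,
    hcycle.1.cycleType, Multiset.singleton_add]

theorem parts_partition_eq_cons_of_mem_cycleFactorsFinset {σ c : Equiv.Perm β}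
    (hc : c ∈ σ.cycleFactorsFinset) :
    σ.partition.parts = c.support.card ::ₘ
      (σ.subtypePerm (p := fun x => x ∉ c.support) fun x =>
        not_congr (Equiv.Perm.mem_cycleFactorsFinset_support hc x)).partition.parts := by
  have hcycleType := cycleType_eq_cons_of_mem_cycleFactorsFinset hc
  have hsupport := congrArg Multiset.sum hcycleType
  rw [Multiset.sum_cons, Equiv.Perm.sum_cycleType, Equiv.Perm.sum_cycleType] at hsupport
  rw [Equiv.Perm.parts_partition, Equiv.Perm.parts_partition, hsupport, hcycleType,
    Multiset.cons_add, Fintype.card_subtype_compl, Fintype.card_coe, Nat.sub_sub]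

theorem permTrace_eq_prod_partition [DecidableEq ι] (M : Matrix ι ι R) (σ : Equiv.Perm β) :
    permTrace M σ = (σ.partition.parts.map fun k => (M ^ k).trace).prod := by
  obtain ⟨n, hn⟩ : ∃ n, Fintype.card β = n := ⟨_, rfl⟩
  induction n using Nat.strong_induction_on generalizing β with
  | _ n ih =>
    rcases σ.cycleFactorsFinset.eq_empty_or_nonempty with hσ | ⟨c, hc⟩
    · obtain rfl := Equiv.Perm.cycleFactorsFinset_eq_empty_iff.1 hσ
      simp [permTrace_one, Equiv.Perm.parts_partition]
    · have hsupport : c.support.Nonempty :=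
        (Equiv.Perm.mem_cycleFactorsFinset_iff.1 hc).1.nonempty_support
      have hcard : Fintype.card {x // x ∉ c.support} < n := by
        obtain ⟨x, hx⟩ := hsupport
        exact hn ▸ Fintype.card_subtype_lt (x := x) (not_not_intro hx)
      rw [permTrace_eq_mul_subtypePerm M σ (· ∈ c.support)
          (Equiv.Perm.mem_cycleFactorsFinset_support hc),
        permTrace_subtypePerm_of_isCycleOn M
          (Equiv.Perm.isCycleOn_support_of_mem_cycleFactorsFinset hc) hsupport,
        ih _ hcard _ rfl, parts_partition_eq_cons_of_mem_cycleFactorsFinset hc, Multiset.map_cons,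
        Multiset.prod_cons]

end PermTrace

section ComplexGaussian

/-- The standard complex Gaussian measure, with density `π⁻¹ exp (-|z|²)`. -/
def stdComplexGaussian : Measure ℂ :=
  (volume : Measure ℂ).withDensity fun z => ENNReal.ofReal (Real.pi⁻¹ * Real.exp (-‖z‖ ^ 2))

theorem integral_stdComplexGaussian (f : ℂ → ℂ) :
    ∫ z, f z ∂stdComplexGaussian = ∫ z : ℂ, ((Real.pi⁻¹ * Real.exp (-‖z‖ ^ 2) : ℝ) : ℂ) * f z := by
  unfold stdComplexGaussian
  rw [integral_withDensity_eq_integral_toReal_smul₀ (by fun_prop)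
    (Filter.Eventually.of_forall fun _ => ENNReal.ofReal_lt_top)]
  refine integral_congr_ae (Filter.Eventually.of_forall fun z => ?_)
  have density_nonneg : 0 ≤ Real.pi⁻¹ * Real.exp (-‖z‖ ^ 2) := by positivity
  simp only [ENNReal.toReal_ofReal density_nonneg, Complex.real_smul]

instance isFiniteMeasure_stdComplexGaussian : IsFiniteMeasure stdComplexGaussian := by
  refine isFiniteMeasure_withDensity_ofReal (Integrable.hasFiniteIntegral ?_)
  have gaussian_integrable :=
    (GaussianFourier.integrable_cexp_neg_mul_sq_norm_add (V := ℂ) (b := 1) (by simp) 0 0).re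
  refine (gaussian_integrable.congr (Filter.Eventually.of_forall fun z => ?_)).const_mul _
  change (Complex.exp _).re = _
  rw [← Complex.ofReal_re (Real.exp (-‖z‖ ^ 2))]
  push_cast
  simp

theorem charFun_stdComplexGaussian (t : ℂ) :
    charFun stdComplexGaussian t = Complex.exp (-(‖t‖ : ℂ) ^ 2 / 4) := by
  have hpi : (Real.pi : ℂ) ≠ 0 := by exact_mod_cast Real.pi_ne_zero
  calc charFun stdComplexGaussian t = ∫ v : ℂ, (Real.pi : ℂ)⁻¹ *
        Complex.exp (-1 * (‖v‖ : ℂ) ^ 2 + Complex.I * (inner ℝ t v : ℝ)) := by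
        rw [charFun_apply, integral_stdComplexGaussian]
        refine integral_congr_ae (Filter.Eventually.of_forall fun z => ?_)
        simp only []
        rw [Complex.exp_add, real_inner_comm z t]
        push_cast
        ring_nf
    _ = Complex.exp (-(‖t‖ : ℂ) ^ 2 / 4) := by
        rw [integral_const_mul, GaussianFourier.integral_cexp_neg_mul_sq_norm_add (by simp),
          Complex.finrank_real_complex]
        simp [hpi]

theorem map_rotation_stdComplexGaussian (u : Circle) :
    stdComplexGaussian.map (rotation u) = stdComplexGaussian := by
  refine Measure.ext_of_charFun (funext fun t => ?_)
  rw [charFun_apply, integral_map (by fun_prop) (by fun_prop)]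
  simp_rw [LinearIsometryEquiv.inner_map_eq_flip]
  rw [← charFun_apply, charFun_stdComplexGaussian, charFun_stdComplexGaussian,
    LinearIsometryEquiv.norm_map]

theorem integral_pow_mul_conj_pow_self_stdComplexGaussian (a : ℕ) :
    ∫ z, z ^ a * conj z ^ a ∂stdComplexGaussian = a.factorial := by
  have radial := Complex.integral_rpow_mul_exp_neg_rpow (p := 2) (q := 2 * a) (by norm_num)
    (by have : (0 : ℝ) ≤ a := by positivity
        linarith)
  rw [show ((2 : ℝ) * a + 2) / 2 = a + 1 by ring, Real.Gamma_nat_eq_factorial] at radial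
  calc ∫ z, z ^ a * conj z ^ a ∂stdComplexGaussian = ∫ z : ℂ,
        ((Real.pi⁻¹ * (‖z‖ ^ (2 * (a : ℝ)) * Real.exp (-‖z‖ ^ (2 : ℝ))) : ℝ) : ℂ) := by
        rw [integral_stdComplexGaussian]
        refine integral_congr_ae (Filter.Eventually.of_forall fun z => ?_)
        simp only []
        rw [← mul_pow, Complex.mul_conj, Complex.normSq_eq_norm_sq, Real.rpow_mul (norm_nonneg _),
          Real.rpow_natCast, Real.rpow_two]
        push_cast
        ring
    _ = a.factorial := by
        rw [integral_complex_ofReal, integral_const_mul, radial, mul_div_cancel_left₀ _ two_ne_zero,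
          inv_mul_cancel_left₀ Real.pi_ne_zero, Complex.ofReal_natCast]

theorem integral_pow_mul_conj_pow_stdComplexGaussian_of_ne {a b : ℕ} (hab : a ≠ b) :
    ∫ z, z ^ a * conj z ^ b ∂stdComplexGaussian = 0 := by
  obtain ⟨u, hu⟩ : ∃ u : Circle, (u : ℂ) ^ a * conj (u : ℂ) ^ b = -1 := by
    have hsub : (a : ℂ) - b ≠ 0 := sub_ne_zero.2 (by exact_mod_cast hab)
    refine ⟨Circle.exp (Real.pi / (a - b)), ?_⟩
    rw [Circle.coe_exp, ← Complex.exp_conj, ← Complex.exp_nat_mul, ← Complex.exp_nat_mul,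
      ← Complex.exp_add, ← Complex.exp_pi_mul_I]
    congr 1
    simp only [map_mul, Complex.conj_ofReal, Complex.conj_I]
    push_cast
    rw [mul_neg, mul_neg, ← sub_eq_add_neg, ← sub_mul, ← mul_assoc,
      mul_div_cancel₀ _ hsub]
  have invariance : ∫ z, z ^ a * conj z ^ b ∂stdComplexGaussian =
      -∫ z, z ^ a * conj z ^ b ∂stdComplexGaussian := by
    conv_lhs => rw [← map_rotation_stdComplexGaussian u]
    rw [integral_map (by fun_prop) (Continuous.aestronglyMeasurable (by fun_prop)), ← integral_neg]
    refine integral_congr_ae (Filter.Eventually.of_forall fun z => ?_)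
    simp only [rotation_apply, map_mul, mul_pow]
    linear_combination z ^ a * conj z ^ b * hu
  exact self_eq_neg.1 invariance

theorem integral_pow_mul_conj_pow_stdComplexGaussian (a b : ℕ) :
    ∫ z, z ^ a * conj z ^ b ∂stdComplexGaussian = if a = b then (a.factorial : ℂ) else 0 := by
  split_ifs with hab
  · rw [← hab, integral_pow_mul_conj_pow_self_stdComplexGaussian]
  · exact integral_pow_mul_conj_pow_stdComplexGaussian_of_ne hab

variable {Ω : Type*} [MeasurableSpace Ω] {P : Measure Ω}

/-- A centered complex Gaussian variable `X` with `E |X|² = v` and `E X² = 0`. For `v = 0` this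
is a variable which vanishes almost surely. -/
structure IsCircularGaussian (X : Ω → ℂ) (v : NNReal) (P : Measure Ω) : Prop where
  hasGaussianLaw : HasGaussianLaw X P
  mean : ∫ ω, X ω ∂P = 0
  variance : ∫ ω, X ω * conj (X ω) ∂P = (v : ℂ)
  pseudovariance : ∫ ω, X ω ^ 2 ∂P = 0

namespace IsCircularGaussian

theorem of_ae_eq_zero [IsProbabilityMeasure P] {X : Ω → ℂ} (hX : ∀ᵐ ω ∂P, X ω = 0) :
    IsCircularGaussian X 0 P where
  hasGaussianLaw := by
    have dirac : HasGaussianLaw (fun _ => (0 : ℂ)) P :=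
      ⟨by rw [Measure.map_const, measure_univ, one_smul]; infer_instance⟩
    exact dirac.congr (hX.mono fun _ h => h.symm)
  mean := integral_eq_zero_of_ae hX
  variance := (integral_eq_zero_of_ae (hX.mono fun ω h => by simp [h])).trans (by simp)
  pseudovariance := integral_eq_zero_of_ae (hX.mono fun ω h => by simp [h])

variable {X : Ω → ℂ} {v : NNReal}

theorem variance_inner (hX : IsCircularGaussian X v P) (t : ℂ) :
    Var[fun ω => inner ℝ t (X ω); P] = v * ‖t‖ ^ 2 / 2 := by
  have memLp := hX.hasGaussianLaw.memLp_two
  have integrable_sq : Integrable (fun ω => X ω ^ 2) P := by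
    simpa [sq] using! memLp.integrable_mul memLp
  have integrable_normSq : Integrable (fun ω => X ω * conj (X ω)) P :=
    memLp.integrable_mul memLp.star
  have inner_sq (ω : Ω) : inner ℝ t (X ω) ^ 2 =
      ((conj t ^ 2 * X ω ^ 2 + (‖t‖ ^ 2 : ℝ) * (X ω * conj (X ω))) / 2 : ℂ).re := by
    rw [← Complex.normSq_eq_norm_sq, Complex.normSq_apply]
    simp [Complex.inner, sq]
    ring
  have integrable_inner_sq : Integrable (fun ω =>
      (conj t ^ 2 * X ω ^ 2 + (‖t‖ ^ 2 : ℝ) * (X ω * conj (X ω))) / 2) P :=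
    ((integrable_sq.const_mul _).add (integrable_normSq.const_mul _)).div_const _
  have mean_inner : ∫ ω, inner ℝ t (X ω) ∂P = 0 := by
    have := hX.hasGaussianLaw.isProbabilityMeasure
    rw [integral_inner hX.hasGaussianLaw.integrable, hX.mean, inner_zero_right]
  rw [variance_of_integral_eq_zero
    (by exact aemeasurable_const.inner hX.hasGaussianLaw.aemeasurable) mean_inner]
  simp_rw [inner_sq]
  have real_part := integral_re integrable_inner_sq
  simp only [RCLike.re_to_complex] at real_part
  rw [real_part, integral_div, integral_add (integrable_sq.const_mul _)
    (integrable_normSq.const_mul _), integral_const_mul, integral_const_mul, hX.variance,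
    hX.pseudovariance, mul_zero, zero_add]
  norm_cast
  ring

theorem map_eq_map_smul_stdComplexGaussian (hX : IsCircularGaussian X v P) :
    P.map X = stdComplexGaussian.map fun z => √v • z := by
  have := hX.hasGaussianLaw.isProbabilityMeasure
  have := hX.hasGaussianLaw.isGaussian_map
  refine Measure.ext_of_charFun (funext fun t => ?_)
  rw [charFun_map_smul, charFun_stdComplexGaussian, hX.hasGaussianLaw.charFun_map_eq,
    integral_inner hX.hasGaussianLaw.integrable, hX.mean, inner_zero_right, hX.variance_inner,
    norm_smul, Real.norm_of_nonneg (Real.sqrt_nonneg _)]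
  simp only [Complex.ofReal_zero, zero_mul, zero_sub, ← Complex.ofReal_pow, mul_pow,
    Real.sq_sqrt v.coe_nonneg]
  push_cast
  ring_nf

theorem integral_pow_mul_conj_pow (hX : IsCircularGaussian X v P) (a b : ℕ) :
    ∫ ω, X ω ^ a * conj (X ω) ^ b ∂P = if a = b then (v : ℂ) ^ a * a.factorial else 0 := by
  rw [← integral_map (f := fun z => z ^ a * conj z ^ b) hX.hasGaussianLaw.aemeasurable
      (Continuous.aestronglyMeasurable (by fun_prop)),
    hX.map_eq_map_smul_stdComplexGaussian,
    integral_map (by fun_prop) (Continuous.aestronglyMeasurable (by fun_prop))]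
  have homogeneous (z : ℂ) : (√v • z) ^ a * conj (√v • z) ^ b =
      (√v : ℂ) ^ (a + b) * (z ^ a * conj z ^ b) := by
    simp only [Complex.real_smul, map_mul, Complex.conj_ofReal]
    ring
  simp_rw [homogeneous]
  rw [integral_const_mul, integral_pow_mul_conj_pow_stdComplexGaussian]
  split_ifs with hab
  · rw [← hab, ← two_mul, pow_mul, ← Complex.ofReal_pow, Real.sq_sqrt v.coe_nonneg]
  · rw [mul_zero]

end IsCircularGaussian

end ComplexGaussian

section Wick

variable {α κ : Type*} [Fintype α]

theorem card_perm_comp_eq_self [DecidableEq α] [Fintype κ] [DecidableEq κ] (x : α → κ) :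
    (Finset.univ.filter fun σ : Equiv.Perm α => x ∘ σ = x).card =
      ∏ p, (Finset.univ.filter fun m => x m = p).card.factorial := by
  simp only [← Fintype.card_subtype]
  exact DomMulAct.stabilizer_card x

theorem exists_perm_comp_eq_of_card_fiber_eq [DecidableEq κ] {x y : α → κ}
    (h : ∀ p, (Finset.univ.filter fun m => x m = p).card =
      (Finset.univ.filter fun m => y m = p).card) :
    ∃ σ : Equiv.Perm α, y ∘ σ = x := by
  have fiberEquiv (p : κ) : Nonempty ({m // x m = p} ≃ {m // y m = p}) :=
    Fintype.card_eq.1 (by simpa only [Fintype.card_subtype] using h p)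
  exact ⟨Equiv.ofFiberEquiv fun p => (fiberEquiv p).some, funext (Equiv.ofFiberEquiv_map _)⟩

theorem card_fiber_comp_perm [DecidableEq κ] (y : α → κ) (σ : Equiv.Perm α) (p : κ) :
    (Finset.univ.filter fun m => (y ∘ σ) m = p).card = (Finset.univ.filter fun m => y m = p).card :=
  Finset.card_equiv σ (by simp)

theorem card_perm_comp_eq [DecidableEq α] [Fintype κ] [DecidableEq κ] (x y : α → κ) :
    (Finset.univ.filter fun σ : Equiv.Perm α => y ∘ σ = x).card =
      ∏ p, if (Finset.univ.filter fun m => x m = p).card =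
          (Finset.univ.filter fun m => y m = p).card
        then (Finset.univ.filter fun m => x m = p).card.factorial else 0 := by
  by_cases h : ∃ σ : Equiv.Perm α, y ∘ σ = x
  · obtain ⟨s, rfl⟩ := h
    simp only [card_fiber_comp_perm, if_true, ← card_perm_comp_eq_self]
    refine Finset.card_equiv (Equiv.mulRight s⁻¹) fun σ => ?_
    simp only [Finset.mem_filter, Finset.mem_univ, true_and, funext_iff, Function.comp_apply,
      Equiv.coe_mulRight, Equiv.Perm.mul_apply]
    exact ⟨fun h m => by simpa using h (s⁻¹ m), fun h m => by simpa using h (s m)⟩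
  · have : ∃ p, (Finset.univ.filter fun m => x m = p).card ≠
        (Finset.univ.filter fun m => y m = p).card := by
      contrapose! h
      exact exists_perm_comp_eq_of_card_fiber_eq h
    obtain ⟨p, hp⟩ := this
    rw [Finset.prod_eq_zero (Finset.mem_univ p) (if_neg hp), Finset.card_eq_zero,
      Finset.filter_eq_empty_iff]
    exact fun σ _ hσ => h ⟨σ, hσ⟩

theorem prod_comp_eq_prod_pow_card {R : Type*} [Fintype κ] [DecidableEq κ] [CommMonoid R]
    (x : α → κ) (f : κ → R) :
    ∏ m, f (x m) = ∏ p, f p ^ (Finset.univ.filter fun m => x m = p).card := by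
  simp_rw [← Finset.prod_const, Finset.prod_fiberwise']

variable {Ω : Type*} [MeasurableSpace Ω] {P : Measure Ω}

theorem memLp_prod_of_forall_memLp [IsFiniteMeasure P] {𝕜 : Type*} [NormedField 𝕜] {f : α → Ω → 𝕜}
    (hf : ∀ m (q : ENNReal), q ≠ ⊤ → MemLp (f m) q P) {p : ENNReal} (hp : p ≠ ⊤) :
    MemLp (fun ω => ∏ m, f m ω) p P := by
  refine MemLp.mono_exponent (MemLp.prod' (s := Finset.univ) (p := fun _ => p * Fintype.card α)
    fun m _ => hf m _ (by finiteness)) ?_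
  rw [ENNReal.le_inv_iff_le_inv, Finset.sum_const, nsmul_eq_mul, Finset.card_univ,
    ENNReal.mul_inv (by simp) (by simp [hp]), mul_left_comm]
  exact mul_le_of_le_one_right' (ENNReal.mul_inv_le_one _)

theorem integrable_prod_mul_conj [IsFiniteMeasure P] {z : κ → Ω → ℂ}
    (hz : ∀ p (q : ENNReal), q ≠ ⊤ → MemLp (z p) q P) (x y : α → κ) :
    Integrable (fun ω => ∏ m, z (x m) ω * conj (z (y m) ω)) P := by
  simp_rw [Finset.prod_mul_distrib]
  exact (memLp_prod_of_forall_memLp (fun m => hz (x m)) (p := 2) (by simp)).integrable_mul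
    (memLp_prod_of_forall_memLp (fun m q hq => (hz (y m) q hq).star) (p := 2) (by simp))

theorem integral_prod_mul_conj [Finite κ] [DecidableEq α] [DecidableEq κ] {z : κ → Ω → ℂ}
    {v : κ → NNReal} (hindep : iIndepFun z P) (hz : ∀ p, IsCircularGaussian (z p) (v p) P)
    (x y : α → κ) :
    ∫ ω, ∏ m, z (x m) ω * conj (z (y m) ω) ∂P =
      (∏ m, (v (x m) : ℂ)) * (Finset.univ.filter fun σ : Equiv.Perm α => y ∘ σ = x).card := by
  have := Fintype.ofFinite κ
  let multiplicity (x : α → κ) (p : κ) : ℕ := (Finset.univ.filter fun m => x m = p).card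
  calc ∫ ω, ∏ m, z (x m) ω * conj (z (y m) ω) ∂P
      = ∫ ω, ∏ p, z p ω ^ multiplicity x p * conj (z p ω) ^ multiplicity y p ∂P := by
        simp_rw [Finset.prod_mul_distrib]
        refine integral_congr_ae (Filter.Eventually.of_forall fun ω => ?_)
        exact congrArg₂ _ (prod_comp_eq_prod_pow_card x fun p => z p ω)
          (prod_comp_eq_prod_pow_card y fun p => conj (z p ω))
    _ = ∏ p, ∫ ω, z p ω ^ multiplicity x p * conj (z p ω) ^ multiplicity y p ∂P :=
        hindep.integral_fun_prod_comp
          (f := fun p w => w ^ multiplicity x p * conj w ^ multiplicity y p)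
          (fun p => (hz p).hasGaussianLaw.aemeasurable)
          fun p => Continuous.aestronglyMeasurable (by fun_prop)
    _ = _ := by
        rw [prod_comp_eq_prod_pow_card x fun p => (v p : ℂ), card_perm_comp_eq, Nat.cast_prod,
          ← Finset.prod_mul_distrib]
        refine Finset.prod_congr rfl fun p _ => ?_
        rw [(hz p).integral_pow_mul_conj_pow]
        rw [Nat.cast_ite, Nat.cast_zero, mul_ite, mul_zero]

end Wick

section GaussianMatrix

variable {l N : ℕ}

theorem cycleTraceProd_inv (π : Equiv.Perm (Fin l)) (A : Matrix (Fin N) (Fin N) ℂ) :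
    cycleTraceProd π⁻¹ A = cycleTraceProd π A := by
  simp only [cycleTraceProd, Equiv.Perm.parts_partition, Equiv.Perm.cycleType_inv,
    Equiv.Perm.support_inv]

theorem cycleTraceProd_eq_sum (π : Equiv.Perm (Fin l)) (A : Matrix (Fin N) (Fin N) ℂ) :
    cycleTraceProd π A = ∑ c : Fin l → Fin N × Fin N,
      ∏ m, A (c m).2 (c m).1 * conj (A (c (π m)).2 (c m).1) := by
  rw [cycleTraceProd, ← permTrace_eq_prod_partition,
    ← (Equiv.arrowProdEquivProdArrow (Fin l) (fun _ => Fin N) fun _ => Fin N).symm.sum_comp,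
    Fintype.sum_prod_type_right]
  refine Finset.sum_congr rfl fun a _ => ?_
  simp_rw [Matrix.mul_apply]
  rw [Finset.prod_univ_sum, Fintype.piFinset_univ]
  rfl

open Classical in
/-- The permutations `σ` that preserve the row of the labelling `c` of `γ` by pairs (row, column)
and such that `π * σ` preserves its column. They index the Wick pairings which contribute to the
expectation of `cycleTraceProd π`. -/
def compatiblePerms {γ κ κ' : Type*} [Fintype γ] (π : Equiv.Perm γ) (c : γ → κ × κ') :
    Finset (Equiv.Perm γ) :=
  Finset.univ.filter fun σ => (∀ m, (c (σ m)).1 = (c m).1) ∧ ∀ m, (c (π (σ m))).2 = (c m).2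

theorem mem_compatiblePerms {γ κ κ' : Type*} [Fintype γ] {π σ : Equiv.Perm γ} {c : γ → κ × κ'} :
    σ ∈ compatiblePerms π c ↔
      (∀ m, (c (σ m)).1 = (c m).1) ∧ ∀ m, (c (π (σ m))).2 = (c m).2 := by
  simp [compatiblePerms]

variable {Ω : Type*} [MeasurableSpace Ω] {P : Measure Ω} {T : Ω → Matrix (Fin N) (Fin N) ℂ}
  {v : Fin N → Fin N → NNReal}

theorem integrable_cycleTraceProd [IsFiniteMeasure P] (π : Equiv.Perm (Fin l))
    (hT : ∀ i j (q : ENNReal), q ≠ ⊤ → MemLp (fun ω => T ω i j) q P) :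
    Integrable (fun ω => cycleTraceProd π (T ω)) P := by
  simp_rw [cycleTraceProd_eq_sum]
  exact integrable_finsetSum _ fun c _ => integrable_prod_mul_conj
    (z := fun (p : Fin N × Fin N) ω => T ω p.1 p.2) (fun p => hT p.1 p.2)
    (fun m => ((c m).2, (c m).1)) fun m => ((c (π m)).2, (c m).1)

theorem integral_cycleTraceProd [IsFiniteMeasure P]
    (hindep : iIndepFun (fun (p : Fin N × Fin N) ω => T ω p.1 p.2) P)
    (hT : ∀ i j, IsCircularGaussian (fun ω => T ω i j) (v i j) P) (π : Equiv.Perm (Fin l)) :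
    ∫ ω, cycleTraceProd π (T ω) ∂P = ∑ c : Fin l → Fin N × Fin N,
      (∏ m, (v (c m).2 (c m).1 : ℂ)) * (compatiblePerms π c).card := by
  simp_rw [cycleTraceProd_eq_sum]
  rw [integral_finsetSum _ fun c _ => integrable_prod_mul_conj
    (z := fun (p : Fin N × Fin N) ω => T ω p.1 p.2)
    (fun p _ => (hT p.1 p.2).hasGaussianLaw.memLp)
    (fun m => ((c m).2, (c m).1)) fun m => ((c (π m)).2, (c m).1)]
  refine Finset.sum_congr rfl fun c _ => ?_
  rw [integral_prod_mul_conj (z := fun (p : Fin N × Fin N) ω => T ω p.1 p.2)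
    (v := fun p => v p.1 p.2) hindep (fun p => hT p.1 p.2) (fun m => ((c m).2, (c m).1))
    fun m => ((c (π m)).2, (c m).1)]
  congr 3
  ext σ
  simp only [Finset.mem_filter, Finset.mem_univ, true_and, mem_compatiblePerms, funext_iff,
    Function.comp_apply, Prod.mk.injEq, forall_and]
  exact and_comm

open YoungDiagram

variable {lam : YoungDiagram}

theorem isCircularGaussian_of_isGaussianMatrix [IsProbabilityMeasure P]
    (hT : lam.IsGaussianMatrix P T) (i j : Fin N) :
    IsCircularGaussian (fun ω => T ω i j) (if ((j : ℕ), (i : ℕ)) ∈ lam then 1 else 0) P := by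
  split_ifs with h
  · exact ⟨hT.gaussian i j h, hT.mean i j h, by simpa using hT.variance i j h,
      hT.pseudovariance i j h⟩
  · exact IsCircularGaussian.of_ae_eq_zero (hT.zero i j h)

theorem fst_lt_colLen_zero (x : lam.cells) : x.1.1 < lam.colLen 0 :=
  (lam.mem_iff_lt_colLen.1 x.2).trans_le (lam.colLen_anti _ _ (Nat.zero_le _))

theorem snd_lt_rowLen_zero (x : lam.cells) : x.1.2 < lam.rowLen 0 :=
  (lam.mem_iff_lt_rowLen.1 x.2).trans_le (lam.rowLen_anti _ _ (Nat.zero_le _))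

theorem integral_cycleTraceProd_eq_sum_card_compatiblePerms [IsProbabilityMeasure P]
    (hT : lam.IsGaussianMatrix P T) (hcol : lam.rowLen 0 ≤ N) (hrow : lam.colLen 0 ≤ N)
    (π : Equiv.Perm (Fin l)) :
    ∫ ω, cycleTraceProd π (T ω) ∂P =
      ((∑ F : Fin l → lam.cells, (compatiblePerms π fun m => (F m).1).card : ℕ) : ℂ) := by
  rw [integral_cycleTraceProd hT.indep (isCircularGaussian_of_isGaussianMatrix hT), Nat.cast_sum]
  let toIndex (x : lam.cells) : Fin N × Fin N :=
    (⟨x.1.1, (fst_lt_colLen_zero x).trans_le hrow⟩, ⟨x.1.2, (snd_lt_rowLen_zero x).trans_le hcol⟩)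
  have toIndex_injective : Function.Injective toIndex := fun x y h =>
    Subtype.ext (Prod.ext (congrArg (fun p => (p.1 : ℕ)) h) (congrArg (fun p => (p.2 : ℕ)) h))
  refine (Fintype.sum_of_injective (toIndex ∘ ·) toIndex_injective.comp_left _ _ ?_ ?_).symm
  · intro c hc
    obtain ⟨m, hm⟩ : ∃ m, (((c m).1 : ℕ), ((c m).2 : ℕ)) ∉ lam := by
      contrapose! hc
      exact ⟨fun m => ⟨_, hc m⟩, rfl⟩
    rw [Finset.prod_eq_zero (Finset.mem_univ m) (by simp [hm]), zero_mul]
  · intro F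
    have mem (m : Fin l) : (F m).1 ∈ lam := (F m).2
    have compatiblePerms_eq : (compatiblePerms π fun m => (F m).1) =
        compatiblePerms π (toIndex ∘ F) := by
      ext σ
      simp [mem_compatiblePerms, toIndex]
    simp [compatiblePerms_eq, toIndex, mem]

end GaussianMatrix

section RowColumn

open YoungDiagram

variable {lam : YoungDiagram}

theorem mem_rowGroup {s : Equiv.Perm lam.cells} :
    s ∈ lam.rowGroup ↔ ∀ x : lam.cells, (s x).1.1 = x.1.1 := by
  simp [rowGroup]

theorem mem_colGroup {s : Equiv.Perm lam.cells} :
    s ∈ lam.colGroup ↔ ∀ x : lam.cells, (s x).1.2 = x.1.2 := by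
  simp [colGroup]

theorem mul_mem_rowGroup {s t : Equiv.Perm lam.cells} (hs : s ∈ lam.rowGroup)
    (ht : t ∈ lam.rowGroup) : s * t ∈ lam.rowGroup :=
  mem_rowGroup.2 fun x => (mem_rowGroup.1 hs (t x)).trans (mem_rowGroup.1 ht x)

theorem mul_mem_colGroup {s t : Equiv.Perm lam.cells} (hs : s ∈ lam.colGroup)
    (ht : t ∈ lam.colGroup) : s * t ∈ lam.colGroup :=
  mem_colGroup.2 fun x => (mem_colGroup.1 hs (t x)).trans (mem_colGroup.1 ht x)

theorem inv_mem_rowGroup {s : Equiv.Perm lam.cells} (hs : s ∈ lam.rowGroup) :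
    s⁻¹ ∈ lam.rowGroup :=
  mem_rowGroup.2 fun x => by simpa using (mem_rowGroup.1 hs (s⁻¹ x)).symm

theorem inv_mem_colGroup {s : Equiv.Perm lam.cells} (hs : s ∈ lam.colGroup) :
    s⁻¹ ∈ lam.colGroup :=
  mem_colGroup.2 fun x => by simpa using (mem_colGroup.1 hs (s⁻¹ x)).symm

theorem eq_one_of_mem_rowGroup_of_mem_colGroup {s : Equiv.Perm lam.cells} (hs : s ∈ lam.rowGroup)
    (hs' : s ∈ lam.colGroup) : s = 1 :=
  Equiv.ext fun x => Subtype.ext (Prod.ext (mem_rowGroup.1 hs x) (mem_colGroup.1 hs' x))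

theorem swap_mem_rowGroup {x y : lam.cells} (h : x.1.1 = y.1.1) :
    Equiv.swap x y ∈ lam.rowGroup :=
  mem_rowGroup.2 fun _ => Equiv.apply_swap_eq_self (v := fun z : lam.cells => z.1.1) h _

theorem swap_mem_colGroup {x y : lam.cells} (h : x.1.2 = y.1.2) :
    Equiv.swap x y ∈ lam.colGroup :=
  mem_colGroup.2 fun _ => Equiv.apply_swap_eq_self (v := fun z : lam.cells => z.1.2) h _

theorem snd_lt_rowLen_fst (x : lam.cells) : x.1.2 < lam.rowLen x.1.1 :=
  lam.mem_iff_lt_rowLen.1 x.2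

theorem card_filter_fst_eq_and_snd_lt (r k : ℕ) :
    (Finset.univ.filter fun y : lam.cells => y.1.1 = r ∧ y.1.2 < k).card =
      min (lam.rowLen r) k := by
  rw [← Finset.card_range (min _ _)]
  refine Finset.card_nbij (fun y => y.1.2) (fun y hy => ?_) (fun y hy z hz hyz => ?_) fun c hc => ?_
  · obtain ⟨rfl, hk⟩ : y.1.1 = r ∧ y.1.2 < k := by simpa using hy
    simpa using ⟨snd_lt_rowLen_fst y, hk⟩
  · obtain ⟨hyr, -⟩ : y.1.1 = r ∧ y.1.2 < k := by simpa using hy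
    obtain ⟨hzr, -⟩ : z.1.1 = r ∧ z.1.2 < k := by simpa using hz
    exact Subtype.ext (Prod.ext (hyr.trans hzr.symm) hyz)
  · obtain ⟨hr, hk⟩ : c < lam.rowLen r ∧ c < k := by simpa using hc
    exact ⟨⟨(r, c), lam.mem_iff_lt_rowLen.2 hr⟩, by simpa using hk, rfl⟩

theorem card_filter_fst_eq_and_snd_apply_lt_le {g : lam.cells → lam.cells}
    (hg : Function.Injective fun x : lam.cells => (x.1.1, (g x).1.2)) (r k : ℕ) :
    (Finset.univ.filter fun y : lam.cells => y.1.1 = r ∧ (g y).1.2 < k).card ≤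
      (Finset.univ.filter fun y : lam.cells => y.1.1 = r ∧ y.1.2 < k).card := by
  rcases le_total (lam.rowLen r) k with hr | hr
  · refine Finset.card_le_card fun y hy => ?_
    obtain ⟨rfl, -⟩ : y.1.1 = r ∧ (g y).1.2 < k := by simpa using hy
    simpa using (snd_lt_rowLen_fst y).trans_le hr
  · rw [card_filter_fst_eq_and_snd_lt, min_eq_right hr]
    conv_rhs => rw [← Finset.card_range k]
    refine Finset.card_le_card_of_injOn (fun y => (g y).1.2) (fun y hy => by simp_all)
      fun y hy z hz hyz => ?_
    have same_row : y.1.1 = z.1.1 := by simp_all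
    exact hg (Prod.ext same_row hyz)

-- The totals over all rows agree, so the inequality above is an equality in every row.
theorem card_filter_fst_eq_and_snd_apply_lt {g : Equiv.Perm lam.cells}
    (hg : Function.Injective fun x : lam.cells => (x.1.1, (g x).1.2)) (r k : ℕ) :
    (Finset.univ.filter fun y : lam.cells => y.1.1 = r ∧ (g y).1.2 < k).card =
      (Finset.univ.filter fun y : lam.cells => y.1.1 = r ∧ y.1.2 < k).card := by
  by_cases hr : r ∈ Finset.univ.image fun y : lam.cells => y.1.1
  · have sum_rows (p : lam.cells → Prop) [DecidablePred p] :
        ∑ r ∈ Finset.univ.image fun y : lam.cells => y.1.1,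
          (Finset.univ.filter fun y : lam.cells => y.1.1 = r ∧ p y).card =
            (Finset.univ.filter p).card := by
      rw [Finset.card_eq_sum_card_fiberwise fun y _ =>
        Finset.mem_coe.2 (Finset.mem_image_of_mem (fun y : lam.cells => y.1.1) (Finset.mem_univ y))]
      simp only [Finset.filter_filter, and_comm]
    refine (Finset.sum_eq_sum_iff_of_le
      fun r _ => card_filter_fst_eq_and_snd_apply_lt_le hg r k).1 ?_ r hr
    rw [sum_rows, sum_rows]
    exact Finset.card_equiv g (by simp)
  · have empty_row (y : lam.cells) : y.1.1 ≠ r := fun h =>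
      hr (Finset.mem_image.2 ⟨y, Finset.mem_univ y, h⟩)
    simp [empty_row]

theorem mk_fst_snd_apply_mem {g : Equiv.Perm lam.cells}
    (hg : Function.Injective fun x : lam.cells => (x.1.1, (g x).1.2)) (x : lam.cells) :
    (x.1.1, (g x).1.2) ∈ lam := by
  have subset : (Finset.univ.filter fun y : lam.cells =>
      y.1.1 = x.1.1 ∧ (g y).1.2 < lam.rowLen x.1.1) ⊆
      Finset.univ.filter fun y : lam.cells => y.1.1 = x.1.1 ∧ y.1.2 < lam.rowLen x.1.1 :=
    fun y hy => by
      obtain ⟨hyx, -⟩ := (Finset.mem_filter.1 hy).2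
      simpa [hyx] using hyx ▸ snd_lt_rowLen_fst y
  have eq := Finset.eq_of_subset_of_card_le subset (card_filter_fst_eq_and_snd_apply_lt hg _ _).ge
  have hx : x ∈ Finset.univ.filter fun y : lam.cells =>
      y.1.1 = x.1.1 ∧ y.1.2 < lam.rowLen x.1.1 := by
    simpa using snd_lt_rowLen_fst x
  rw [← eq, Finset.mem_filter] at hx
  exact lam.mem_iff_lt_rowLen.2 hx.2.2

theorem exists_mem_rowGroup_mul_mem_colGroup {g : Equiv.Perm lam.cells}
    (hg : Function.Injective fun x : lam.cells => (x.1.1, (g x).1.2)) :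
    ∃ p ∈ lam.rowGroup, g * p ∈ lam.colGroup := by
  let move (x : lam.cells) : lam.cells := ⟨(x.1.1, (g x).1.2), mk_fst_snd_apply_mem hg x⟩
  have move_injective : Function.Injective move := fun x y h => hg (congrArg Subtype.val h)
  let p : Equiv.Perm lam.cells :=
    Equiv.ofBijective move (Finite.injective_iff_bijective.1 move_injective)
  have hp : p ∈ lam.rowGroup := mem_rowGroup.2 fun _ => rfl
  have col_eq (x : lam.cells) : (p x).1.2 = (g x).1.2 := rfl
  refine ⟨p⁻¹, inv_mem_rowGroup hp, mem_colGroup.2 fun x => ?_⟩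
  rw [Equiv.Perm.mul_apply, ← col_eq, ← Equiv.Perm.mul_apply, mul_inv_cancel, Equiv.Perm.one_apply]

end RowColumn

section YoungSymmetrizer

open YoungDiagram

variable {lam : YoungDiagram}

/-- The elements of the group algebra on which the column group acts by the sign from the left and
the row group acts trivially from the right. The Young symmetrizer spans the space of these. -/
structure IsYoungSymmetric (x : lam.BoxAlgebra) : Prop where
  single_mul : ∀ q ∈ lam.colGroup,
    MonoidAlgebra.single q (1 : ℂ) * x = ((Equiv.Perm.sign q : ℤ) : ℂ) • x
  mul_single : ∀ p ∈ lam.rowGroup, x * MonoidAlgebra.single p (1 : ℂ) = x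

namespace IsYoungSymmetric

variable {x : lam.BoxAlgebra}

theorem mul {y : lam.BoxAlgebra} (hx : IsYoungSymmetric x) (hy : IsYoungSymmetric y) :
    IsYoungSymmetric (x * y) where
  single_mul q hq := by rw [← mul_assoc, hx.single_mul q hq, smul_mul_assoc]
  mul_single p hp := by rw [mul_assoc, hy.mul_single p hp]

theorem coeff_mul_left (hx : IsYoungSymmetric x) {q : Equiv.Perm lam.cells}
    (hq : q ∈ lam.colGroup) (g : Equiv.Perm lam.cells) :
    x.coeff (q * g) = ((Equiv.Perm.sign q : ℤ) : ℂ) * x.coeff g := by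
  simpa using congrArg (fun z => z.coeff g) (hx.single_mul q⁻¹ (inv_mem_colGroup hq))

theorem coeff_mul_right (hx : IsYoungSymmetric x) {p : Equiv.Perm lam.cells}
    (hp : p ∈ lam.rowGroup) (g : Equiv.Perm lam.cells) : x.coeff (g * p) = x.coeff g := by
  simpa using congrArg (fun z => z.coeff g) (hx.mul_single p⁻¹ (inv_mem_rowGroup hp))

theorem coeff_eq_sign_mul (hx : IsYoungSymmetric x) {g p : Equiv.Perm lam.cells}
    (hp : p ∈ lam.rowGroup) (hgp : g * p ∈ lam.colGroup) :
    x.coeff g = ((Equiv.Perm.sign (g * p) : ℤ) : ℂ) * x.coeff 1 := by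
  rw [← hx.coeff_mul_right hp, ← hx.coeff_mul_left hgp, mul_one]

-- Two boxes of one row that `g` sends to one column give `g s = t g` with transpositions `s` in
-- the row group and `t` in the column group, and then `x.coeff g = -x.coeff g`.
theorem coeff_eq_zero (hx : IsYoungSymmetric x) {g : Equiv.Perm lam.cells}
    (hg : ¬ ∃ p ∈ lam.rowGroup, g * p ∈ lam.colGroup) : x.coeff g = 0 := by
  obtain ⟨a, b, hab, hne⟩ := Function.not_injective_iff.1
    (mt exists_mem_rowGroup_mul_mem_colGroup hg)
  obtain ⟨same_row, same_col⟩ := Prod.ext_iff.1 hab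
  have coeff_mul_swap := hx.coeff_mul_right (swap_mem_rowGroup same_row) g
  rw [Equiv.mul_swap_eq_swap_mul, hx.coeff_mul_left (swap_mem_colGroup same_col),
    Equiv.Perm.sign_swap (g.injective.ne hne)] at coeff_mul_swap
  exact self_eq_neg.1 (by simpa using coeff_mul_swap.symm)

end IsYoungSymmetric

theorem single_mul_sum_colGroup {q : Equiv.Perm lam.cells} (hq : q ∈ lam.colGroup) :
    (MonoidAlgebra.single q 1 * ∑ s ∈ lam.colGroup,
      MonoidAlgebra.single s ((Equiv.Perm.sign s : ℤ) : ℂ) : lam.BoxAlgebra) =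
      ((Equiv.Perm.sign q : ℤ) : ℂ) • ∑ s ∈ lam.colGroup,
        MonoidAlgebra.single s ((Equiv.Perm.sign s : ℤ) : ℂ) := by
  rw [Finset.mul_sum, Finset.smul_sum]
  refine Finset.sum_nbij' (q * ·) (q⁻¹ * ·) (fun s hs => mul_mem_colGroup hq hs)
    (fun s hs => mul_mem_colGroup (inv_mem_colGroup hq) hs) (by simp) (by simp) fun s _ => ?_
  rw [MonoidAlgebra.single_mul_single, one_mul, MonoidAlgebra.smul_single, smul_eq_mul,
    Equiv.Perm.sign_mul, Units.val_mul, Int.cast_mul, ← mul_assoc, ← Int.cast_mul,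
    ← Units.val_mul, Int.units_mul_self]
  simp

theorem sum_rowGroup_mul_single {p : Equiv.Perm lam.cells} (hp : p ∈ lam.rowGroup) :
    ((∑ s ∈ lam.rowGroup, MonoidAlgebra.single s 1) * MonoidAlgebra.single p 1 : lam.BoxAlgebra) =
      ∑ s ∈ lam.rowGroup, MonoidAlgebra.single s 1 := by
  rw [Finset.sum_mul]
  refine Finset.sum_nbij' (· * p) (· * p⁻¹) (fun s hs => mul_mem_rowGroup hs hp)
    (fun s hs => mul_mem_rowGroup hs (inv_mem_rowGroup hp)) (by simp) (by simp) fun s _ => ?_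
  rw [MonoidAlgebra.single_mul_single, one_mul]

theorem isYoungSymmetric_symmetrizer : IsYoungSymmetric lam.symmetrizer where
  single_mul q hq := by
    rw [symmetrizer, ← mul_assoc, single_mul_sum_colGroup hq, smul_mul_assoc]
  mul_single p hp := by rw [symmetrizer, mul_assoc, sum_rowGroup_mul_single hp]

open Classical in
theorem coeff_symmetrizer (w : Equiv.Perm lam.cells) :
    lam.symmetrizer.coeff w = ∑ p ∈ lam.rowGroup with w * p ∈ lam.colGroup,
      ((Equiv.Perm.sign (w * p) : ℤ) : ℂ) := by
  rw [symmetrizer, Finset.mul_sum, MonoidAlgebra.coeff_sum, Finsupp.finsetSum_apply,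
    Finset.sum_filter]
  refine Finset.sum_nbij' (·⁻¹) (·⁻¹) (fun _ => inv_mem_rowGroup) (fun _ => inv_mem_rowGroup)
    (by simp) (by simp) fun p _ => ?_
  rw [MonoidAlgebra.coeff_mul_single_apply, mul_one, MonoidAlgebra.coeff_sum,
    Finsupp.finsetSum_apply]
  simp [Finsupp.single_apply]

theorem coeff_symmetrizer_one : lam.symmetrizer.coeff 1 = 1 := by
  classical
  have factorization_unique :
      (lam.rowGroup.filter fun p => 1 * p ∈ lam.colGroup) = {1} := by
    ext p
    simp only [Finset.mem_filter, Finset.mem_singleton, one_mul]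
    refine ⟨fun h => eq_one_of_mem_rowGroup_of_mem_colGroup h.1 h.2, ?_⟩
    rintro rfl
    simp [mem_rowGroup, mem_colGroup]
  rw [coeff_symmetrizer, factorization_unique]
  simp

open Classical in
theorem norm_coeff_symmetrizer_le (w : Equiv.Perm lam.cells) :
    ‖lam.symmetrizer.coeff w‖ ≤
      (lam.rowGroup.filter fun p => w * p ∈ lam.colGroup).card := by
  rw [coeff_symmetrizer]
  refine (norm_sum_le_of_le _ (n := fun _ => 1) fun p _ => ?_).trans (by simp)
  rcases Int.units_eq_one_or (Equiv.Perm.sign (w * p)) with h | h <;> simp [h]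

theorem IsYoungSymmetric.eq_smul_symmetrizer {x : lam.BoxAlgebra} (hx : IsYoungSymmetric x) :
    x = x.coeff 1 • lam.symmetrizer := by
  refine MonoidAlgebra.ext (Finsupp.ext fun g => ?_)
  rw [MonoidAlgebra.coeff_smul, Finsupp.smul_apply, smul_eq_mul]
  by_cases hg : ∃ p ∈ lam.rowGroup, g * p ∈ lam.colGroup
  · obtain ⟨p, hp, hgp⟩ := hg
    rw [hx.coeff_eq_sign_mul hp hgp, isYoungSymmetric_symmetrizer.coeff_eq_sign_mul hp hgp,
      coeff_symmetrizer_one, mul_one, mul_comm]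
  · rw [hx.coeff_eq_zero hg, isYoungSymmetric_symmetrizer.coeff_eq_zero hg, mul_zero]

theorem symmetrizer_mul_symmetrizer :
    lam.symmetrizer * lam.symmetrizer =
      (lam.symmetrizer * lam.symmetrizer).coeff 1 • lam.symmetrizer :=
  (isYoungSymmetric_symmetrizer.mul isYoungSymmetric_symmetrizer).eq_smul_symmetrizer

end YoungSymmetrizer

section Character

theorem mul_trace_restrict_range {K V : Type*} [Field K] [AddCommGroup V] [Module K V]
    [FiniteDimensional K V] {f g : V →ₗ[K] V} {α : K} (hf : f ∘ₗ f = α • f)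
    (hg : ∀ v ∈ LinearMap.range f, g v ∈ LinearMap.range f) :
    α * LinearMap.trace K (LinearMap.range f) (g.restrict hg) = LinearMap.trace K V (g ∘ₗ f) := by
  have range_comp : f.rangeRestrict ∘ₗ g ∘ₗ (LinearMap.range f).subtype =
      α • g.restrict hg := by
    ext ⟨v, hv⟩
    obtain ⟨w, hw⟩ := hg v hv
    simpa [← hw] using LinearMap.congr_fun hf w
  have factorization : g ∘ₗ f = (g ∘ₗ (LinearMap.range f).subtype) ∘ₗ f.rangeRestrict := rfl
  rw [factorization, LinearMap.trace_comp_comm', range_comp, map_smul, smul_eq_mul]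

theorem trace_mulLeft_single_comp_mulRight {R G : Type*} [CommRing R] [Group G] [Fintype G]
    (g : G) (c : MonoidAlgebra R G) :
    LinearMap.trace R (MonoidAlgebra R G)
      (LinearMap.mulLeft R (MonoidAlgebra.single g 1) ∘ₗ LinearMap.mulRight R c) =
      ∑ h : G, c.coeff (h⁻¹ * g⁻¹ * h) := by
  classical
  rw [LinearMap.trace_eq_matrix_trace R (MonoidAlgebra.basis G R), Matrix.trace]
  refine Finset.sum_congr rfl fun h _ => ?_
  rw [Matrix.diag_apply, LinearMap.toMatrix_apply, MonoidAlgebra.basis_apply]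
  change (MonoidAlgebra.single g 1 * (MonoidAlgebra.single h 1 * c)).coeff h = _
  simp [mul_assoc]

open YoungDiagram

variable {lam : YoungDiagram}

theorem coeff_mul_trace_boxIrrep (g : Equiv.Perm lam.cells) :
    (lam.symmetrizer * lam.symmetrizer).coeff 1 *
        LinearMap.trace ℂ lam.irrepSpace (lam.boxIrrep g) =
      ∑ h : Equiv.Perm lam.cells, lam.symmetrizer.coeff (h⁻¹ * g⁻¹ * h) := by
  rw [← trace_mulLeft_single_comp_mulRight]
  refine mul_trace_restrict_range ?_ (lam.mulLeft_mem_irrepSpace _)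
  rw [← LinearMap.mulRight_mul]
  conv_lhs => rw [symmetrizer_mul_symmetrizer]
  ext
  simp

theorem trace_boxIrrep_div_trace_boxIrrep_one (g : Equiv.Perm lam.cells) :
    LinearMap.trace ℂ lam.irrepSpace (lam.boxIrrep g) /
        LinearMap.trace ℂ lam.irrepSpace (lam.boxIrrep 1) =
      (∑ h : Equiv.Perm lam.cells, lam.symmetrizer.coeff (h⁻¹ * g⁻¹ * h)) / lam.card.factorial := by
  have dimension : (lam.symmetrizer * lam.symmetrizer).coeff 1 *
      LinearMap.trace ℂ lam.irrepSpace (lam.boxIrrep 1) = lam.card.factorial := by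
    rw [coeff_mul_trace_boxIrrep]
    simp [coeff_symmetrizer_one, Fintype.card_perm, YoungDiagram.card]
  have coeff_ne_zero : (lam.symmetrizer * lam.symmetrizer).coeff 1 ≠ 0 :=
    left_ne_zero_of_mul (dimension ▸ Nat.cast_ne_zero.2 (Nat.factorial_ne_zero _))
  rw [← coeff_mul_trace_boxIrrep, ← dimension, mul_div_mul_left _ _ coeff_ne_zero]

theorem chi_eq_sum_coeff_symmetrizer (π : Equiv.Perm (Fin lam.card)) :
    lam.chi π = (∑ f : Fin lam.card ≃ lam.cells, lam.symmetrizer.coeff (f.permCongr π⁻¹)) /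
      lam.card.factorial := by
  have irrep_apply (g : Equiv.Perm (Fin lam.card)) :
      lam.irrep g = lam.boxIrrep (lam.cells.equivFin.symm.permCongrHom g) := rfl
  rw [chi, irrep_apply, irrep_apply, map_one, trace_boxIrrep_div_trace_boxIrrep_one]
  congr 1
  exact Fintype.sum_equiv ((Equiv.inv _).trans
    (Equiv.equivCongr lam.cells.equivFin (Equiv.refl lam.cells))) _ _ fun _ => rfl

end Character

section ViaEmbedding

variable {α β γ : Type*}

theorem permCongr_viaEmbedding (π : Equiv.Perm γ) (ι : γ ↪ α) (f : α ≃ β) :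
    f.permCongr (π.viaEmbedding ι) = π.viaEmbedding (ι.trans f.toEmbedding) := by
  ext x
  obtain ⟨x, rfl⟩ := f.surjective x
  rw [Equiv.permCongr_apply, Equiv.symm_apply_apply]
  by_cases hx : x ∈ Set.range ι
  · obtain ⟨m, rfl⟩ := hx
    rw [Equiv.Perm.viaEmbedding_apply]
    exact (Equiv.Perm.viaEmbedding_apply π (ι.trans f.toEmbedding) m).symm
  · rw [Equiv.Perm.viaEmbedding_apply_of_notMem _ _ _ hx,
      Equiv.Perm.viaEmbedding_apply_of_notMem _ _ _ (by simpa using hx)]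

theorem exists_viaEmbedding_eq (F : γ ↪ β) {p : Equiv.Perm β}
    (hp : ∀ x ∉ Set.range F, p x = x) : ∃ σ : Equiv.Perm γ, σ.viaEmbedding F = p := by
  have mapsTo_iff (x : β) : p x ∈ Set.range F ↔ x ∈ Set.range F := by
    refine not_iff_not.1 ⟨fun hx => ?_, fun hx => (hp x hx).symm ▸ hx⟩
    rwa [p.injective (hp _ hx)] at hx
  let σ : Equiv.Perm γ :=
    (Equiv.ofInjective F F.injective).symm.permCongr (p.subtypePerm mapsTo_iff)
  refine ⟨σ, Equiv.ext fun x => ?_⟩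
  by_cases hx : x ∈ Set.range F
  · obtain ⟨m, rfl⟩ := hx
    rw [Equiv.Perm.viaEmbedding_apply]
    simp [σ, Equiv.permCongr_apply, Equiv.apply_ofInjective_symm]
  · rw [Equiv.Perm.viaEmbedding_apply_of_notMem _ _ _ hx, hp x hx]

theorem card_compl_range [Fintype α] [Fintype γ] (ι : γ ↪ α) [Fintype ((Set.range ι)ᶜ : Set α)] :
    Fintype.card ((Set.range ι)ᶜ : Set α) = Fintype.card α - Fintype.card γ := by
  classical
  rw [Fintype.card_compl_set, Set.card_range_of_injective ι.injective]

theorem card_equiv_trans_eq [Fintype α] [Fintype β] [Fintype γ] [DecidableEq α] [DecidableEq β]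
    [DecidableEq (γ ↪ β)] (h : Fintype.card α = Fintype.card β) (ι : γ ↪ α) (F : γ ↪ β) :
    (Finset.univ.filter fun f : α ≃ β => ι.trans f.toEmbedding = F).card =
      (Fintype.card α - Fintype.card γ).factorial := by
  classical
  let ranges : Set.range ι ≃ Set.range F :=
    (Equiv.ofInjective ι ι.injective).symm.trans (Equiv.ofInjective F F.injective)
  have extends_iff (f : α ≃ β) :
      ι.trans f.toEmbedding = F ↔ ∀ x : Set.range ι, f x = ranges x := by
    simp only [DFunLike.ext_iff, Set.forall_subtype_range_iff, ranges, Equiv.trans_apply,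
      Equiv.ofInjective_symm_apply]
    rfl
  have card_compl_eq : Fintype.card ((Set.range ι)ᶜ : Set α) =
      Fintype.card ((Set.range F)ᶜ : Set β) := by
    rw [card_compl_range, card_compl_range, h]
  rw [← Fintype.card_subtype, Fintype.card_congr
    ((Equiv.subtypeEquivRight extends_iff).trans (Equiv.Set.compl ranges)),
    Fintype.card_equiv (Fintype.equivOfCardEq card_compl_eq), card_compl_range]

theorem sum_equiv_trans [Fintype α] [Fintype β] [Fintype γ] [DecidableEq α] [DecidableEq β]
    {M : Type*} [AddCommMonoid M] (h : Fintype.card α = Fintype.card β) (ι : γ ↪ α)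
    (φ : (γ ↪ β) → M) :
    ∑ f : α ≃ β, φ (ι.trans f.toEmbedding) =
      (Fintype.card α - Fintype.card γ).factorial • ∑ F : γ ↪ β, φ F := by
  classical
  rw [← Finset.sum_fiberwise' Finset.univ fun f : α ≃ β => ι.trans f.toEmbedding,
    Finset.smul_sum]
  simp_rw [Finset.sum_const, card_equiv_trans_eq h]

end ViaEmbedding

section CharacterBound

open YoungDiagram

variable {lam : YoungDiagram}

theorem normalizedChar_eq_sum_coeff_symmetrizer {l : ℕ} (hl : l ≤ lam.card)
    (π : Equiv.Perm (Fin l)) :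
    lam.normalizedChar hl π =
      ∑ F : Fin l ↪ lam.cells, lam.symmetrizer.coeff (π⁻¹.viaEmbedding F) := by
  have hcard : Fintype.card (Fin lam.card) = Fintype.card lam.cells := by simp [YoungDiagram.card]
  have viaEmbedding_inv : (π.viaEmbedding (Fin.castLEEmb hl))⁻¹ =
      π⁻¹.viaEmbedding (Fin.castLEEmb hl) :=
    (map_inv (Equiv.Perm.viaEmbeddingHom (Fin.castLEEmb hl)) π).symm
  have factorial_ne_zero : ((lam.card - l).factorial : ℂ) ≠ 0 :=
    Nat.cast_ne_zero.2 (Nat.factorial_ne_zero _)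
  have descFactorial_ne_zero : (lam.card.descFactorial l : ℂ) ≠ 0 :=
    Nat.cast_ne_zero.2 (Nat.descFactorial_pos.2 hl).ne'
  rw [normalizedChar, chi_eq_sum_coeff_symmetrizer, viaEmbedding_inv]
  simp_rw [permCongr_viaEmbedding]
  rw [sum_equiv_trans hcard (Fin.castLEEmb hl) fun F => lam.symmetrizer.coeff (π⁻¹.viaEmbedding F),
    nsmul_eq_mul, Fintype.card_fin, Fintype.card_fin, ← Nat.factorial_mul_descFactorial hl,
    Nat.cast_mul]
  field_simp

theorem apply_eq_self_of_mul_mem_colGroup {w p : Equiv.Perm lam.cells} (hp : p ∈ lam.rowGroup)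
    (hwp : w * p ∈ lam.colGroup) {x : lam.cells} (hx : w x = x) : p x = x := by
  have inv_apply : p⁻¹ x = x := by
    refine Subtype.ext (Prod.ext (mem_rowGroup.1 (inv_mem_rowGroup hp) x) ?_)
    have same_col := mem_colGroup.1 (inv_mem_colGroup hwp) x
    rwa [mul_inv_rev, Equiv.Perm.mul_apply, Equiv.Perm.inv_eq_iff_eq.2 hx.symm] at same_col
  exact (Equiv.Perm.inv_eq_iff_eq.1 inv_apply).symm

theorem norm_coeff_symmetrizer_viaEmbedding_le {γ : Type*} [Fintype γ] (π : Equiv.Perm γ)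
    (F : γ ↪ lam.cells) :
    ‖lam.symmetrizer.coeff (π.viaEmbedding F)‖ ≤ (compatiblePerms π fun m => (F m).1).card := by
  classical
  refine (norm_coeff_symmetrizer_le _).trans (Nat.cast_le.2 ?_)
  refine Finset.card_le_card_of_surjOn (fun σ => σ.viaEmbedding F) fun p hp => ?_
  obtain ⟨hrow, hcol⟩ := Finset.mem_filter.1 hp
  obtain ⟨σ, rfl⟩ := exists_viaEmbedding_eq F fun x hx =>
    apply_eq_self_of_mul_mem_colGroup hrow hcol (π.viaEmbedding_apply_of_notMem F x hx)
  refine ⟨σ, mem_compatiblePerms.2 ⟨fun m => ?_, fun m => ?_⟩, rfl⟩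
  · rw [← σ.viaEmbedding_apply F, mem_rowGroup.1 hrow]
  · rw [← π.viaEmbedding_apply F, ← σ.viaEmbedding_apply F, ← Equiv.Perm.mul_apply,
      mem_colGroup.1 hcol]

theorem norm_normalizedChar_le {l : ℕ} (hl : l ≤ lam.card) (π : Equiv.Perm (Fin l)) :
    ‖lam.normalizedChar hl π‖ ≤
      ((∑ F : Fin l → lam.cells, (compatiblePerms π⁻¹ fun m => (F m).1).card : ℕ) : ℝ) := by
  rw [normalizedChar_eq_sum_coeff_symmetrizer, Nat.cast_sum]
  calc ‖∑ F : Fin l ↪ lam.cells, lam.symmetrizer.coeff (π⁻¹.viaEmbedding F)‖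
      ≤ ∑ F : Fin l ↪ lam.cells, ((compatiblePerms π⁻¹ fun m => (F m).1).card : ℝ) :=
        norm_sum_le_of_le _ fun F _ => norm_coeff_symmetrizer_viaEmbedding_le π⁻¹ F
    _ ≤ ∑ F : Fin l → lam.cells, ((compatiblePerms π⁻¹ fun m => (F m).1).card : ℝ) :=
        (Finset.sum_map Finset.univ ⟨_, DFunLike.coe_injective⟩ fun F : Fin l → lam.cells =>
          ((compatiblePerms π⁻¹ fun m => (F m).1).card : ℝ)).symm.trans_le
          (Finset.sum_le_univ_sum_of_nonneg fun _ => Nat.cast_nonneg _)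

end CharacterBound

end

theorem mainTheorem11 (lam : YoungDiagram) {l : ℕ} (hl : l ≤ lam.card) (π : Equiv.Perm (Fin l))
    {Ω : Type*} [MeasurableSpace Ω] (P : Measure Ω) [IsProbabilityMeasure P]
    {N : ℕ} (hcol : lam.rowLen 0 ≤ N) (hrow : lam.colLen 0 ≤ N)
    (T : Ω → Matrix (Fin N) (Fin N) ℂ) (hT : lam.IsGaussianMatrix P T) :
    Integrable (fun ω => cycleTraceProd π (T ω)) P ∧
      (∫ ω, cycleTraceProd π (T ω) ∂P).im = 0 ∧
      ‖lam.normalizedChar hl π‖ ≤ (∫ ω, cycleTraceProd π (T ω) ∂P).re := by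
  have integrable := integrable_cycleTraceProd π fun i j _ =>
    (isCircularGaussian_of_isGaussianMatrix hT i j).hasGaussianLaw.memLp
  have expectation := integral_cycleTraceProd_eq_sum_card_compatiblePerms hT hcol hrow π⁻¹
  simp_rw [cycleTraceProd_inv] at expectation
  rw [expectation, Complex.natCast_im, Complex.natCast_re]
  exact ⟨integrable, rfl, norm_normalizedChar_le hl π⟩
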